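/- **Setting.** Let $\mathcal Z$ be a nonempty compact space with its Borel $\sigma$-algebra and $\mathcal P$ the set of all Borel probability distributions on $\mathcal Z$. Let $\mathcal F$ be a nonempty convex compact subset of a real topological vector space, and let $\ell:\mathcal Z\times\mathcal F\to\mathbb R$ be continuous (hence bounded) and such that $\ell(z,\cdot)$ is convex for every $z$. The minimax regret of the $T$-round online convex optimization game is $$\mathcal R_T=\inf_{f_1\in\mathcal F}\sup_{z_1\in\mathcal Z}\cdots\inf_{f_T\in\mathcal F}\sup_{z_T\in\mathcal Z}\Big(\sum_{t=1}^T\ell(z_t,f_t)-\inf_{f\in\mathcal F}\sum_{t=1}^T\ell(z_t,f)\Big),$$ and the minimum expected loss functional is $\Phi(p)=\inf_{f\in\mathcal F}\mathbb E_{Z\sim p}\,\ell(Z,f)$ for $p\in\mathcal P$. Put $\|p-q\|_1=\int_{\mathcal Z}|dp-dq|$. The functional $\Phi$ is *differentiable* if for each $p\in\mathcal P$ there is a linear functional $\nabla\Phi(p)$ on signed measures with $\lim_{s\downarrow0}\frac{\Phi((1-s)p+sq)-\Phi(p)}{s}=\langle\nabla\Phi(p),q-p\rangle$ for all $q\in\mathcal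 P$ (Gâteaux differentiability). For $\alpha\ge 0$, the concave functional $\Phi$ is *$\alpha$-flat* with respect to $\|\cdot\|_1$ if $$-\Phi(q)+\Phi(p)\le-\langle\nabla\Phi(p),q-p\rangle+\alpha\|q-p\|_1^2\qquad\text{for all }p,q\in\mathcal P.$$ **Theorem.** Suppose that $\Phi$ is differentiable and $\alpha$-flat with respect to $\|\cdot\|_1$ on $\mathcal P$. Then $\mathcal R_T\le 4\alpha\log T$ for every $T\ge 3$, and $\mathcal R_T\le 4\alpha(1+\log T)$ for every $T\ge1$. -/

import Mathlib

open MeasureTheory Filter Topology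

noncomputable section

namespace OnlineConvex

variable {Z E : Type*}

/-- The regret of a finished play, listed as pairs (adversary's move, player's move):
`∑ ℓ(z_t, f_t) - inf_{f ∈ F} ∑ ℓ(z_t, f)`. -/
def regret (l : Z → E → ℝ) (F : Set E) (h : List (Z × E)) : ℝ :=
  (h.map fun x => l x.1 x.2).sum - ⨅ f : F, (h.map fun x => l x.1 f).sum

/-- The value of the game with `n` rounds left after the play `h`:
`inf_{f ∈ F} sup_{z ∈ Z} ⋯ inf_{f ∈ F} sup_{z ∈ Z}` (`n` pairs) of the regret. -/
def valueAfter (l : Z → E → ℝ) (F : Set E) : ℕ → List (Z × E) → ℝ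
  | 0, h => regret l F h
  | n + 1, h => ⨅ f : F, ⨆ z : Z, valueAfter l F n ((z, (f : E)) :: h)

/-- The minimax regret of the game with `T` rounds. -/
def minimaxRegret (l : Z → E → ℝ) (F : Set E) (T : ℕ) : ℝ :=
  valueAfter l F T []

variable [MeasurableSpace Z]

/-- The minimum expected loss functional `p ↦ inf_{f ∈ F} 𝔼_{Z ∼ p} ℓ(Z, f)`. -/
def minExpectedLoss (l : Z → E → ℝ) (F : Set E) (p : Measure Z) : ℝ :=
  ⨅ f : F, ∫ z, l z f ∂p

/-- `p - q` as a signed measure. -/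
def diff (p q : Measure Z) [IsFiniteMeasure p] [IsFiniteMeasure q] : SignedMeasure Z :=
  p.toSignedMeasure - q.toSignedMeasure

/-- `‖p - q‖₁ = ∫ |dp - dq|`, the total mass of the total variation measure of `p - q`. -/
def l1Dist (p q : Measure Z) [IsFiniteMeasure p] [IsFiniteMeasure q] : ℝ :=
  (diff p q).totalVariation.real Set.univ

/-- The linear functional `L` is a Gâteaux derivative at the distribution `p` of the functional `G`
on the convex set of probability distributions: for each distribution `q`, the derivative of `G` at
`p` in the direction `q - p` is `L (q - p)`.
Continuity of `L` is not asked for, so every Fréchet derivative with respect to `‖·‖₁`, and every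
gradient in the form of a function paired with `q - p` by integration, is such an `L`. Only the
values of `G` at probability measures matter. -/
def HasGateauxDerivAt (G : Measure Z → ℝ) (L : SignedMeasure Z →ₗ[ℝ] ℝ)
    (p : Measure Z) [IsProbabilityMeasure p] : Prop :=
  ∀ (q : Measure Z) [IsProbabilityMeasure q],
    Tendsto (fun s : ℝ => (G (ENNReal.ofReal (1 - s) • p + ENNReal.ofReal s • q) - G p) / s)
      (𝓝[>] 0) (𝓝 (L (diff q p)))

/-- `G` is differentiable on the set of probability distributions. -/
def DifferentiableOnDistributions (G : Measure Z → ℝ) : Prop :=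
  ∀ (p : Measure Z) [IsProbabilityMeasure p],
    ∃ L : SignedMeasure Z →ₗ[ℝ] ℝ, HasGateauxDerivAt G L p

/-- A (convex) functional `G` on the set of probability distributions is `α`-flat with respect to
`‖·‖₁`: `G q - G p ≤ ⟨∇G(p), q - p⟩ + α ‖q - p‖₁²` for all distributions `p, q`. The derivative is
determined by `G` on the differences `q - p`, so that its choice is immaterial. -/
def IsFlat (α : ℝ) (G : Measure Z → ℝ) : Prop :=
  ∀ (p : Measure Z) [IsProbabilityMeasure p],
    ∃ L : SignedMeasure Z →ₗ[ℝ] ℝ, HasGateauxDerivAt G L p ∧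
      ∀ (q : Measure Z) [IsProbabilityMeasure q],
        G q - G p ≤ L (diff q p) + α * l1Dist q p ^ 2

/-- A concave functional is `α`-flat when its negative is. -/
def IsFlatConcave (α : ℝ) (G : Measure Z → ℝ) : Prop :=
  IsFlat α fun p => -G p

end OnlineConvex

end

/-! Extend Φ to finite measures by homogeneity and use it as a potential. If ν counts the
adversary's moves so far and t = ν(Z) + 1, the player wants one f with l(z, f) ≤ Φ(ν + δ_z) − Φ(ν) +
2α/t for every z. Such moves make the losses telescope to Φ of the final counting measure, which is
the comparator term, so the regret is at most 2α ∑ 1/t ≤ 2α(1 + log T).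

Compactness and a finite minimax principle (`exists_forall_lt_of_forall_stdSimplex`) reduce the
existence of f to mixtures of finitely many z. There it follows from a reverse Jensen inequality,
Φ(ν + ∑ xᵢ δ_{zᵢ}) ≤ ∑ xᵢ Φ(ν + δ_{zᵢ}) + 2α/t (`minExpectedLoss_addMasses_le`). Flatness is applied
along edges of the simplex (`le_sum_vertices_add`), which halves the constant obtained by comparing
the mean directly with the vertices. -/

namespace OnlineConvex

/-! ### Simplex inequality, finite minimax, total variation -/

/-- A function on the simplex that is supported from below, up to the error `2 c ε²`, along every
edge direction exceeds its affine interpolation at `x` by at most `c (1 - ∑ xᵢ²)`. -/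
theorem le_sum_vertices_add {ι : Type*} [Fintype ι] [DecidableEq ι] (g : (ι → ℝ) → ℝ) (c : ℝ)
    (hg : ∀ x ∈ stdSimplex ℝ ι, ∀ i j, ∃ d : ℝ, ∀ ε : ℝ,
      x + ε • (Pi.single i 1 - Pi.single j 1) ∈ stdSimplex ℝ ι →
      g x ≤ g (x + ε • (Pi.single i 1 - Pi.single j 1)) + d * ε + 2 * c * ε ^ 2)
    (x : ι → ℝ) (hx : x ∈ stdSimplex ℝ ι) :
    g x ≤ ∑ i, x i * g (Pi.single i 1) + c * (1 - ∑ i, x i ^ 2) := by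
  -- Split x along an edge into two points of smaller support whose weighted mean is x.
  induction hn : (Finset.univ.filter fun i => x i ≠ 0).card using Nat.strong_induction_on
    generalizing x with
  | _ n ih =>
  by_cases h : ∃ i j, i ≠ j ∧ x i ≠ 0 ∧ x j ≠ 0
  · obtain ⟨i, j, hij, hi, hj⟩ := h
    have hi' : 0 < x i := lt_of_le_of_ne (hx.1 i) (Ne.symm hi)
    have hj' : 0 < x j := lt_of_le_of_ne (hx.1 j) (Ne.symm hj)
    obtain ⟨d, hd⟩ := hg x hx i j
    have hsum : ∀ (ε : ℝ) (w : ι → ℝ),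
        ∑ k, (x + ε • (Pi.single i 1 - Pi.single j 1) : ι → ℝ) k * w k
          = ∑ k, x k * w k + ε * (w i - w j) := by
      intro ε w
      simp [add_mul, Finset.sum_add_distrib, sub_mul,
        Finset.sum_sub_distrib, Pi.single_apply, mul_sub]
    have hsq : ∀ ε : ℝ, ∑ k, (x + ε • (Pi.single i 1 - Pi.single j 1) : ι → ℝ) k ^ 2
        = ∑ k, x k ^ 2 + 2 * ε * (x i - x j) + 2 * ε ^ 2 := by
      intro ε
      have h1 := hsum ε (x + ε • (Pi.single i 1 - Pi.single j 1) : ι → ℝ)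
      have h2 := hsum ε x
      simp only [← pow_two] at h1
      rw [h1]
      have h3 : ∀ k, x k * (x + ε • (Pi.single i 1 - Pi.single j 1) : ι → ℝ) k
        = (x + ε • (Pi.single i 1 - Pi.single j 1) : ι → ℝ) k * x k := fun k => mul_comm _ _
      rw [Finset.sum_congr rfl fun k _ => h3 k, h2]
      simp only [← pow_two, Pi.add_apply, Pi.smul_apply, Pi.sub_apply, Pi.single_apply,
        if_true, hij, hij.symm, if_false, smul_eq_mul]
      ring
    have hmem : ∀ ε : ℝ, -x i ≤ ε → ε ≤ x j →
        (x + ε • (Pi.single i 1 - Pi.single j 1) : ι → ℝ) ∈ stdSimplex ℝ ι := by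
      intro ε h1 h2
      refine ⟨fun k => ?_, ?_⟩
      · by_cases hki : k = i
        · subst hki; simp [hij]; linarith
        · by_cases hkj : k = j
          · subst hkj; simp [hki]; linarith
          · simp [hki, hkj]; exact hx.1 k
      · have := hsum ε 1
        simpa [hx.2] using this
    have hcard : ∀ (ε : ℝ) (m : ι), (m = i ∨ m = j) →
        (x + ε • (Pi.single i 1 - Pi.single j 1) : ι → ℝ) m = 0 →
        (Finset.univ.filter fun k =>
          (x + ε • (Pi.single i 1 - Pi.single j 1) : ι → ℝ) k ≠ 0).card < n := by
      intro ε m hm h0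
      rw [← hn]
      refine Finset.card_lt_card ⟨fun k hk => ?_, fun hs => ?_⟩
      · simp only [Finset.mem_filter, Finset.mem_univ, true_and] at hk ⊢
        by_cases hki : k = i
        · subst hki; exact hi
        · by_cases hkj : k = j
          · subst hkj; exact hj
          · simpa [Pi.single_apply, hki, hkj] using hk
      · have : m ∈ Finset.univ.filter fun k => x k ≠ 0 := by
          rcases hm with rfl | rfl <;> simp [hi, hj]
        have := hs this
        simp only [Finset.mem_filter, Finset.mem_univ, true_and] at this
        exact this h0
    have m1 := hmem (x j) (by linarith) le_rfl
    have m2 := hmem (-x i) le_rfl (by linarith)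
    have i1 := ih _ (hcard (x j) j (Or.inr rfl) (by simp [hij.symm])) _ m1 rfl
    have i2 := ih _ (hcard (-x i) i (Or.inl rfl) (by simp [hij])) _ m2 rfl
    have d1 := hd _ m1
    have d2 := hd _ m2
    rw [hsum, hsq] at i1 i2
    -- The steps x j and −x i, with weights proportional to x i and x j, have mean 0 and variance x
    -- i * x j. So `d` cancels, and the error 2c * x i * x j is exactly the mean drop of c(1 − ∑
    -- xᵢ²).
    have e1 := mul_le_mul_of_nonneg_left (add_le_add d1 i1) hi'.le
    have e2 := mul_le_mul_of_nonneg_left (add_le_add d2 i2) hj'.le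
    have : (x i + x j) * g x ≤
        (x i + x j) * (∑ i, x i * g (Pi.single i 1) + c * (1 - ∑ i, x i ^ 2)) := by
      linarith
    exact le_of_mul_le_mul_left this (by linarith)
  · push Not at h
    have hne : ∃ i, x i ≠ 0 := by
      by_contra! h0
      have := hx.2
      simp [h0] at this
    obtain ⟨i, hi⟩ := hne
    have h0 : ∀ j, j ≠ i → x j = 0 := fun j hj => h i j hj.symm hi
    have hxi : x i = 1 := by
      rw [← hx.2]; exact (Finset.sum_eq_single i (fun j _ hj => h0 j hj) (by simp)).symm
    have hxs : x = Pi.single i 1 := by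
      funext j
      by_cases hj : j = i
      · subst hj; simp [hxi]
      · simp [hj, h0 j hj]
    rw [hxs]
    simp [Pi.single_apply]

/-- A finite minimax principle: if every convex combination of the convex functions `a i` takes a
negative value, then they are simultaneously negative at some point. -/
theorem exists_forall_lt_of_forall_stdSimplex {ι E : Type*} [Fintype ι] [AddCommGroup E]
    [Module ℝ E] {F : Set E} (hF : F.Nonempty) (hFc : Convex ℝ F) (a : ι → E → ℝ)
    (ha : ∀ i, ConvexOn ℝ F (a i))
    (h : ∀ x ∈ stdSimplex ℝ ι, ∃ f ∈ F, ∑ i, x i * a i f < 0) :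
    ∃ f ∈ F, ∀ i, a i f < 0 := by
  classical
  by_contra! hcon
  -- Separating 0 from this open convex set yields, up to sign and normalization, the mixture that
  -- contradicts `h`.
  let C : Set (ι → ℝ) := {u | ∃ f ∈ F, ∀ i, a i f < u i}
  have hC0 : (0 : ι → ℝ) ∉ C := by
    rintro ⟨f, hf, h1⟩
    obtain ⟨i, hi⟩ := hcon f hf
    exact (h1 i).not_ge hi
  have hCopen : IsOpen C := by
    have : C = ⋃ f ∈ F, ⋂ i, {u : ι → ℝ | a i f < u i} := by
      ext u; simp [C]
    rw [this]
    exact isOpen_biUnion fun f _ => isOpen_iInter_of_finite fun i =>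
      isOpen_lt continuous_const (continuous_apply i)
  have hCconv : Convex ℝ C := by
    rintro u ⟨f, hf, hu⟩ v ⟨f', hf', hv⟩ b c hb hc hbc
    refine ⟨b • f + c • f', hFc hf hf' hb hc hbc, fun i => ?_⟩
    refine ((ha i).2 hf hf' hb hc hbc).trans_lt ?_
    simp only [smul_eq_mul, Pi.add_apply, Pi.smul_apply]
    rcases hb.eq_or_lt with rfl | hb
    · have : c = 1 := by linarith
      simpa [this] using hv i
    · exact add_lt_add_of_lt_of_le (mul_lt_mul_of_pos_left (hu i) hb)
        (mul_le_mul_of_nonneg_left (hv i).le hc)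
  obtain ⟨p, hp⟩ := geometric_hahn_banach_open_point hCconv hCopen hC0
  rw [map_zero] at hp
  let q : ι → ℝ := fun i => -p (Pi.single i 1)
  have hpq : ∀ u : ι → ℝ, p u = -∑ i, u i * q i := by
    intro u
    conv_lhs => rw [← Finset.univ_sum_single u]
    rw [map_sum, ← Finset.sum_neg_distrib]
    refine Finset.sum_congr rfl fun i _ => ?_
    have : (Pi.single i (u i) : ι → ℝ) = u i • Pi.single i 1 := by
      rw [← Pi.single_smul, smul_eq_mul, mul_one]
    rw [this, map_smul, smul_eq_mul]
    simp [q]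
  have hshift : ∀ f ∈ F, ∀ w : ι → ℝ, (∀ i, 0 < w i) → 0 < ∑ i, (a i f + w i) * q i := by
    intro f hf w hw
    have := hp (fun i => a i f + w i) ⟨f, hf, fun i => by linarith [hw i]⟩
    rw [hpq] at this
    linarith
  have hlim : ∀ f ∈ F, 0 ≤ ∑ i, a i f * q i := by
    intro f hf
    have hc : Continuous fun s : ℝ => ∑ i, (a i f + s) * q i := by fun_prop
    have ht : Tendsto (fun s : ℝ => ∑ i, (a i f + s) * q i) (𝓝[>] 0)
        (𝓝 (∑ i, a i f * q i)) := by
      simpa using (hc.tendsto 0).mono_left nhdsWithin_le_nhds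
    exact ge_of_tendsto ht (eventually_nhdsWithin_of_forall fun s hs =>
      (hshift f hf (fun _ => s) fun _ => hs).le)
  obtain ⟨f₀, hf₀⟩ := hF
  have hq : ∀ i, 0 ≤ q i := by
    intro i
    by_contra! hi
    have hw := fun s (hs : 0 < s) => hshift f₀ hf₀ (fun j => if j = i then s else 1)
      (fun j => by split_ifs <;> linarith)
    set A := ∑ j, (a j f₀ + 1) * q j with hA
    have hsplit : ∀ s : ℝ, ∑ j, (a j f₀ + (if j = i then s else 1)) * q j
        = A + (s - 1) * q i := by
      intro s
      have : ∀ j, (a j f₀ + (if j = i then s else 1)) * q j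
          = (a j f₀ + 1) * q j + if j = i then (s - 1) * q i else 0 := by
        intro j
        split_ifs with hj
        · subst hj; ring
        · ring
      simp only [this, Finset.sum_add_distrib, Finset.sum_ite_eq', Finset.mem_univ, if_true, hA]
    -- This s turns A + (s − 1) * q i into A − |A| ≤ 0.
    have h2 := hw (|A| / (-q i) + 1) (add_pos_of_nonneg_of_pos
      (div_nonneg (abs_nonneg A) (by linarith)) one_pos)
    rw [hsplit, add_sub_cancel_right, div_mul_eq_mul_div, div_neg, mul_div_assoc,
      div_self hi.ne] at h2
    linarith [le_abs_self A]
  have hs : 0 < ∑ i, q i := by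
    refine lt_of_le_of_ne (Finset.sum_nonneg fun i _ => hq i) fun h0 => ?_
    have h1 := (Finset.sum_eq_zero_iff_of_nonneg fun i _ => hq i).1 h0.symm
    have := hshift f₀ hf₀ 1 (fun _ => one_pos)
    simp [fun i => h1 i (Finset.mem_univ i)] at this
  obtain ⟨f, hf, hneg⟩ := h (fun i => q i / ∑ j, q j)
    ⟨fun i => div_nonneg (hq i) hs.le, by rw [← Finset.sum_div, div_self hs.ne']⟩
  have h1 : ∑ i, q i / (∑ j, q j) * a i f = (∑ i, a i f * q i) / ∑ j, q j := by
    rw [Finset.sum_div]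
    exact Finset.sum_congr rfl fun i _ => by ring
  rw [h1] at hneg
  exact hneg.not_ge (div_nonneg (hlim f hf) hs.le)

/-- On each half of a Hahn decomposition, `diff μ ν` is a difference of two numbers in [0, 1], so
each half contributes at most |c|. -/
theorem l1Dist_le_of_diff_eq {Z : Type*} [MeasurableSpace Z] (p q μ ν : Measure Z)
    [IsProbabilityMeasure p] [IsProbabilityMeasure q] [IsProbabilityMeasure μ] [IsProbabilityMeasure ν] (c : ℝ)
    (h : diff p q = c • diff μ ν) : l1Dist p q ≤ 2 * |c| := by
  obtain ⟨s, hs, _, _, hpos, hneg⟩ := (diff p q).toJordanDecomposition_spec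
  have hb : ∀ t, MeasurableSet t → |diff p q t| ≤ |c| := by
    intro t ht
    rw [h]
    simp only [diff, FunLike.coe_smul, Pi.smul_apply, _root_.sub_apply, smul_eq_mul,
      Measure.toSignedMeasure_apply_measurable ht, abs_mul]
    refine mul_le_of_le_one_right (abs_nonneg c) (abs_le.2 ⟨?_, ?_⟩) <;>
    linarith [measureReal_nonneg (μ := μ) (s := t), measureReal_nonneg (μ := ν) (s := t),
      measureReal_le_one (μ := μ) (s := t), measureReal_le_one (μ := ν) (s := t)]
  have h1 := abs_le.1 (hb s hs)
  have h2 := abs_le.1 (hb sᶜ hs.compl)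
  rw [l1Dist, SignedMeasure.totalVariation, measureReal_add_apply, hpos, hneg,
    SignedMeasure.toMeasureOfZeroLE_real_apply _ _ _ MeasurableSet.univ,
    SignedMeasure.toMeasureOfLEZero_real_apply _ _ _ MeasurableSet.univ,
    Set.inter_univ, Set.inter_univ]
  linarith [h1.2, h2.1]

/-! ### Point masses and the reverse Jensen inequality -/

section Measures

variable {Z E : Type*} [MeasurableSpace Z]

/-- The measure `ν` with additional point masses `x i` at the points `z i`. -/
noncomputable def addMasses {ι : Type*} [Fintype ι] (ν : Measure Z) (z : ι → Z) (x : ι → ℝ) :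
    Measure Z :=
  ν + ∑ i, ENNReal.ofReal (x i) • Measure.dirac (z i)

variable {ι : Type*} [Fintype ι] {ν : Measure Z} {z : ι → Z} {x : ι → ℝ}

instance [IsFiniteMeasure ν] : IsFiniteMeasure (addMasses ν z x) := by
  have : ∀ i, IsFiniteMeasure (ENNReal.ofReal (x i) • Measure.dirac (z i)) := fun i =>
    Measure.smul_finite _ ENNReal.ofReal_ne_top
  unfold addMasses
  infer_instance

theorem measureReal_addMasses [IsFiniteMeasure ν] (hx : ∀ i, 0 ≤ x i) (s : Set Z) :
    (addMasses ν z x).real s = ν.real s + ∑ i, x i * (Measure.dirac (z i)).real s := by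
  have : ∀ i, IsFiniteMeasure (ENNReal.ofReal (x i) • Measure.dirac (z i)) := fun i =>
    Measure.smul_finite _ ENNReal.ofReal_ne_top
  rw [addMasses, measureReal_add_apply, measureReal_def (∑ i, _), Measure.finsetSum_apply,
    ENNReal.toReal_sum fun i _ => measure_ne_top _ _]
  simp [measureReal_def, ENNReal.toReal_ofReal (hx _)]

theorem addMasses_single [DecidableEq ι] (i : ι) :
    addMasses ν z (Pi.single i 1) = ν + Measure.dirac (z i) := by
  rw [addMasses, Finset.sum_eq_single i]
  · simp
  · intro j _ hj
    simp [hj]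
  · simp

theorem integral_addMasses [IsFiniteMeasure ν] (hx : ∀ i, 0 ≤ x i) {φ : Z → ℝ}
    (hφ : StronglyMeasurable φ) {M : ℝ} (hM : ∀ z, |φ z| ≤ M) :
    ∫ y, φ y ∂(addMasses ν z x) = ∫ y, φ y ∂ν + ∑ i, x i * φ (z i) := by
  have hint : ∀ μ : Measure Z, IsFiniteMeasure μ → Integrable φ μ := fun μ _ =>
    Integrable.of_bound hφ.aestronglyMeasurable M (Eventually.of_forall hM)
  have hfin : ∀ i, IsFiniteMeasure (ENNReal.ofReal (x i) • Measure.dirac (z i)) := fun i =>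
    Measure.smul_finite _ ENNReal.ofReal_ne_top
  rw [addMasses, integral_add_measure (hint _ inferInstance) (hint _ inferInstance),
    integral_finsetSum_measure fun i _ => hint _ (hfin i)]
  simp [integral_smul_measure, integral_dirac' _ _ hφ, ENNReal.toReal_ofReal (hx _)]

theorem minExpectedLoss_smul (l : Z → E → ℝ) (F : Set E) (μ : Measure Z) {c : ℝ} (hc : 0 ≤ c) :
    minExpectedLoss l F (ENNReal.ofReal c • μ) = c * minExpectedLoss l F μ := by
  simp [minExpectedLoss, integral_smul_measure, ENNReal.toReal_ofReal hc,
    Real.mul_iInf_of_nonneg hc]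

/-- For a flat minimum expected loss `Φ`, adding random point masses to `ν` in place of their
average costs at most `2 α / t`, half of what flatness at the average gives. -/
theorem minExpectedLoss_addMasses_le {l : Z → E → ℝ} {F : Set E} {α : ℝ} (hα : 0 ≤ α)
    (h_flat : IsFlatConcave α (minExpectedLoss l F)) [IsFiniteMeasure ν] [DecidableEq ι]
    {t : ℝ} (ht : ν.real Set.univ + 1 = t) (hx : x ∈ stdSimplex ℝ ι) :
    minExpectedLoss l F (addMasses ν z x) ≤
      ∑ i, x i * minExpectedLoss l F (ν + Measure.dirac (z i)) + 2 * α / t := by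
  have ht0 : 0 < t := by linarith [measureReal_nonneg (μ := ν) (s := Set.univ)]
  have hreal : ∀ w ∈ stdSimplex ℝ ι, ∀ s,
      (ENNReal.ofReal t⁻¹ • addMasses ν z w).real s =
        t⁻¹ * (ν.real s + ∑ i, w i * (Measure.dirac (z i)).real s) := by
    intro w hw s
    rw [measureReal_ennreal_smul_apply, ENNReal.toReal_ofReal (inv_nonneg.2 ht0.le),
      measureReal_addMasses hw.1]
  have hprob : ∀ w ∈ stdSimplex ℝ ι,
      IsProbabilityMeasure (ENNReal.ofReal t⁻¹ • addMasses ν z w) := by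
    intro w hw
    have : IsFiniteMeasure (ENNReal.ofReal t⁻¹ • addMasses ν z w) :=
      Measure.smul_finite _ ENNReal.ofReal_ne_top
    have h1 := hreal w hw Set.univ
    simp only [probReal_univ, mul_one, hw.2, ht, inv_mul_cancel₀ ht0.ne'] at h1
    exact isProbabilityMeasure_iff_real.2 h1
  -- After normalizing by t, an edge step ε has ‖·‖₁ at most 2|ε|/t. Scaling back, flatness costs t
  -- * α * (2ε/t)² = 2 * (2α/t) * ε².
  have key := le_sum_vertices_add (fun w => minExpectedLoss l F (addMasses ν z w)) (2 * α / t)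
    ?_ x hx
  · simp only [addMasses_single] at key
    refine key.trans (add_le_add_right ?_ _)
    exact mul_le_of_le_one_right (by positivity)
      (sub_le_self _ (Finset.sum_nonneg fun i _ => sq_nonneg _))
  · intro w hw i j
    have := hprob w hw
    obtain ⟨L, -, hL⟩ := h_flat (ENNReal.ofReal t⁻¹ • addMasses ν z w)
    refine ⟨L (diff (Measure.dirac (z i)) (Measure.dirac (z j))), fun ε hε => ?_⟩
    have := hprob _ hε
    have hdiff : diff (ENNReal.ofReal t⁻¹ •
          addMasses ν z (w + ε • (Pi.single i 1 - Pi.single j 1)))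
        (ENNReal.ofReal t⁻¹ • addMasses ν z w)
        = (ε / t) • diff (Measure.dirac (z i)) (Measure.dirac (z j)) := by
      ext s hs
      simp only [diff, FunLike.coe_smul, Pi.smul_apply, _root_.sub_apply, smul_eq_mul,
        Measure.toSignedMeasure_apply_measurable hs, hreal _ hw, hreal _ hε, Pi.add_apply,
        Pi.sub_apply, add_mul, Finset.sum_add_distrib]
      have : ∑ k, ε * ((Pi.single i 1 : ι → ℝ) k - (Pi.single j 1 : ι → ℝ) k)
          * (Measure.dirac (z k)).real s
          = ε * ((Measure.dirac (z i)).real s - (Measure.dirac (z j)).real s) := by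
        simp [sub_mul, Finset.sum_sub_distrib, Pi.single_apply, mul_sub]
      rw [this]
      ring
    have h1 := hL (ENNReal.ofReal t⁻¹ •
      addMasses ν z (w + ε • (Pi.single i 1 - Pi.single j 1)))
    have h2 := l1Dist_le_of_diff_eq _ _ _ _ _ hdiff
    beta_reduce at h1
    rw [hdiff, map_smul, minExpectedLoss_smul _ _ _ (inv_nonneg.2 ht0.le),
      minExpectedLoss_smul _ _ _ (inv_nonneg.2 ht0.le), smul_eq_mul] at h1
    have h0 : 0 ≤ l1Dist (ENNReal.ofReal t⁻¹ •
          addMasses ν z (w + ε • (Pi.single i 1 - Pi.single j 1)))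
        (ENNReal.ofReal t⁻¹ • addMasses ν z w) := measureReal_nonneg
    have h3 := mul_le_mul_of_nonneg_left (pow_le_pow_left₀ h0 h2 2) hα
    have h4 := mul_le_mul_of_nonneg_left (h1.trans (add_le_add_right h3 _)) ht0.le
    rw [mul_pow, sq_abs] at h4
    have e : ∀ a b c : ℝ, t * (-(t⁻¹ * a) - -(t⁻¹ * b)) = b - a ∧
        t * (ε / t * c + α * (2 ^ 2 * (ε / t) ^ 2)) = c * ε + 2 * (2 * α / t) * ε ^ 2 := by
      intro a b c
      constructor
      · field_simp
        ring
      · field_simp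
    rw [(e _ _ 0).1, (e 0 0 _).2] at h4
    linarith

end Measures

/-! ### The potential argument for the game -/

section Game

variable {Z E : Type*} {l : Z → E → ℝ} {F : Set E} {M : ℝ}

theorem abs_sum_map_le (hM : ∀ z, ∀ f ∈ F, |l z f| ≤ M) (h : List (Z × E)) (φ : Z × E → E)
    (hφ : ∀ x ∈ h, φ x ∈ F) : |(h.map fun x => l x.1 (φ x)).sum| ≤ M * h.length := by
  induction h with
  | nil => simp
  | cons a h ih =>
    have h1 := ih fun x hx => hφ x (List.mem_cons_of_mem _ hx)
    have h2 := hM a.1 (φ a) (hφ a List.mem_cons_self)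
    simp only [List.map_cons, List.sum_cons, List.length_cons, Nat.cast_add, Nat.cast_one]
    refine (abs_add_le _ _).trans ?_
    linarith

theorem abs_iInf_le {ι : Type*} [Nonempty ι] {φ : ι → ℝ} {B : ℝ} (h : ∀ i, |φ i| ≤ B) :
    |⨅ i, φ i| ≤ B :=
  abs_le.2 ⟨le_ciInf fun i => (abs_le.1 (h i)).1,
    (ciInf_le ⟨-B, by rintro _ ⟨i, rfl⟩; exact (abs_le.1 (h i)).1⟩ (Classical.arbitrary ι)).trans
      (abs_le.1 (h _)).2⟩

theorem abs_iSup_le {ι : Type*} [Nonempty ι] {φ : ι → ℝ} {B : ℝ} (h : ∀ i, |φ i| ≤ B) :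
    |⨆ i, φ i| ≤ B :=
  abs_le.2 ⟨(abs_le.1 (h _)).1.trans
    (le_ciSup ⟨B, by rintro _ ⟨i, rfl⟩; exact (abs_le.1 (h i)).2⟩ (Classical.arbitrary ι)),
    ciSup_le fun i => (abs_le.1 (h i)).2⟩

/-- Needed for the lower bound without which a real infimum over the player's moves need not lie
below its members. -/
theorem abs_valueAfter_le [Nonempty Z] (hF : F.Nonempty) (hM : ∀ z, ∀ f ∈ F, |l z f| ≤ M) (n : ℕ)
    (h : List (Z × E)) (hh : ∀ x ∈ h, x.2 ∈ F) :
    |valueAfter l F n h| ≤ 2 * M * (h.length + n) := by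
  have : Nonempty F := hF.to_subtype
  induction n generalizing h with
  | zero =>
    have h1 := abs_sum_map_le hM h (fun x => x.2) hh
    have h2 : |⨅ f : F, (h.map fun x => l x.1 f).sum| ≤ M * h.length :=
      abs_iInf_le fun f => abs_sum_map_le hM h (fun _ => f) fun _ _ => f.2
    rw [valueAfter, regret]
    refine (abs_sub _ _).trans ?_
    push_cast
    linarith
  | succ n ih =>
    rw [valueAfter]
    refine abs_iInf_le fun f => abs_iSup_le fun z => ?_
    refine (ih ((z, (f : E)) :: h) ?_).trans (le_of_eq ?_)
    · intro x hx
      rcases List.mem_cons.1 hx with rfl | hx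
      · exact f.2
      · exact hh x hx
    · simp only [List.length_cons]
      push_cast
      ring

variable [MeasurableSpace Z]

/-- The counting measure of the adversary's moves in the play `h`. -/
noncomputable def movesMeasure (h : List (Z × E)) : Measure Z :=
  (h.map fun x => Measure.dirac x.1).sum

theorem movesMeasure_cons (x : Z × E) (h : List (Z × E)) :
    movesMeasure (x :: h) = Measure.dirac x.1 + movesMeasure h := by
  simp [movesMeasure]

instance isFiniteMeasure_movesMeasure (h : List (Z × E)) : IsFiniteMeasure (movesMeasure h) := by
  induction h with
  | nil => simp only [movesMeasure, List.map_nil, List.sum_nil]; infer_instance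
  | cons x h ih => rw [movesMeasure_cons]; infer_instance

theorem measureReal_movesMeasure_univ (h : List (Z × E)) :
    (movesMeasure h).real Set.univ = h.length := by
  induction h with
  | nil => simp [movesMeasure]
  | cons x h ih =>
    rw [movesMeasure_cons, measureReal_add_apply, ih]
    simp [add_comm]

theorem integral_movesMeasure {φ : Z → ℝ} (hφ : StronglyMeasurable φ) (hM : ∀ z, |φ z| ≤ M)
    (h : List (Z × E)) : ∫ z, φ z ∂(movesMeasure h) = (h.map fun x => φ x.1).sum := by
  have hint : ∀ μ : Measure Z, IsFiniteMeasure μ → Integrable φ μ := fun μ _ =>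
    Integrable.of_bound hφ.aestronglyMeasurable M (Eventually.of_forall hM)
  induction h with
  | nil => simp [movesMeasure]
  | cons x h ih =>
    rw [movesMeasure_cons, integral_add_measure (hint _ inferInstance) (hint _ inferInstance), ih,
      integral_dirac' _ _ hφ]
    simp

/-- The player's move with which the minimum expected loss, scaled to the measure of the moves
played so far, acts as a potential. -/
theorem exists_forall_le_minExpectedLoss [TopologicalSpace E] [AddCommGroup E] [Module ℝ E]
    (hF : IsCompact F) (hF_conv : Convex ℝ F) (hF_ne : F.Nonempty)
    (hmeas : ∀ f ∈ F, StronglyMeasurable fun z => l z f)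
    (hcont : ∀ z, ContinuousOn (l z) F) (hconv : ∀ z, ConvexOn ℝ F (l z))
    (hM : ∀ z, ∀ f ∈ F, |l z f| ≤ M) {α : ℝ} (hα : 0 ≤ α)
    (h_flat : IsFlatConcave α (minExpectedLoss l F)) (ν : Measure Z) [IsFiniteMeasure ν]
    {t : ℝ} (ht : ν.real Set.univ + 1 = t) :
    ∃ f ∈ F, ∀ z, l z f ≤
      minExpectedLoss l F (ν + Measure.dirac z) - minExpectedLoss l F ν + 2 * α / t := by
  classical
  have hne : Nonempty F := hF_ne.to_subtype
  have hcomp : CompactSpace F := isCompact_iff_compactSpace.1 hF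
  set c : Z → ℝ := fun z =>
    minExpectedLoss l F (ν + Measure.dirac z) - minExpectedLoss l F ν + 2 * α / t with hc
  obtain ⟨f, -, hf⟩ := isCompact_univ.inter_iInter_nonempty
    -- The slack ε supplies the strict inequality in the finite minimax principle; it is removed at
    -- the end.
    (fun k : Z × {ε : ℝ // 0 < ε} => {f : F | l k.1 f ≤ c k.1 + k.2})
    (fun k => isClosed_le (continuousOn_iff_continuous_domRestrict.1 (hcont k.1)) continuous_const)
    (fun u => by
      obtain ⟨f, hf, h⟩ := exists_forall_lt_of_forall_stdSimplex hF_ne hF_conv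
        (fun (k : u) f => l k.1.1 f + -(c k.1.1 + k.1.2))
        (fun k => (hconv k.1.1).add_const _) fun x hx => by
          by_contra! hcon
          have h1 := minExpectedLoss_addMasses_le (z := fun k : u => k.1.1) hα h_flat ht hx
          -- If no f beats the mixture x, Φ at the mixed measure exceeds the reverse Jensen bound by
          -- the mean slack, which is positive.
          have h2 : minExpectedLoss l F ν + ∑ k : u, x k * (c k.1.1 + k.1.2) ≤
              minExpectedLoss l F (addMasses ν (fun k : u => k.1.1) x) := by
            refine le_ciInf fun f => ?_
            rw [integral_addMasses hx.1 (hmeas f f.2) fun z => hM z f f.2]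
            have h3 := hcon f f.2
            simp only [mul_add, Finset.sum_add_distrib, mul_neg, Finset.sum_neg_distrib] at h3 ⊢
            have h4 : minExpectedLoss l F ν ≤ ∫ z, l z f ∂ν := by
              refine ciInf_le ⟨-(M * ν.real Set.univ), ?_⟩ f
              rintro _ ⟨g, rfl⟩
              have : ‖∫ z, l z g ∂ν‖ ≤ M * ν.real Set.univ :=
                norm_integral_le_of_norm_le_const (Eventually.of_forall fun z => hM z g g.2)
              exact (abs_le.1 this).1
            linarith
          have h5 : 0 < ∑ k : u, x k * (k.1.2 : ℝ) := by
            obtain ⟨k, hk⟩ : ∃ k, x k ≠ 0 := by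
              by_contra! h0
              have := hx.2
              simp [h0] at this
            exact Finset.sum_pos' (fun k _ => mul_nonneg (hx.1 k) k.1.2.2.le)
              ⟨k, Finset.mem_univ k, mul_pos ((hx.1 k).lt_of_ne hk.symm) k.1.2.2⟩
          simp only [hc, mul_add, mul_sub, Finset.sum_add_distrib, Finset.sum_sub_distrib,
            ← Finset.sum_mul, hx.2] at h2
          linarith
      refine ⟨⟨f, hf⟩, Set.mem_univ _, Set.mem_iInter₂.2 fun k hk => ?_⟩
      have := h ⟨k, hk⟩
      simp only [Set.mem_ofPred_eq] at this ⊢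
      linarith)
  rw [Set.mem_iInter] at hf
  exact ⟨f, f.2, fun z => le_of_forall_pos_le_add fun ε hε => hf (z, ⟨ε, hε⟩)⟩

/-- Backward induction: the chosen move makes the loss increment at most the potential increment
plus 2α/t, with t = h.length + 1. -/
theorem valueAfter_le [Nonempty Z] [TopologicalSpace E] [AddCommGroup E] [Module ℝ E]
    (hF : IsCompact F) (hF_conv : Convex ℝ F) (hF_ne : F.Nonempty)
    (hmeas : ∀ f ∈ F, StronglyMeasurable fun z => l z f)
    (hcont : ∀ z, ContinuousOn (l z) F) (hconv : ∀ z, ConvexOn ℝ F (l z))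
    (hM : ∀ z, ∀ f ∈ F, |l z f| ≤ M) {α : ℝ} (hα : 0 ≤ α)
    (h_flat : IsFlatConcave α (minExpectedLoss l F)) (n : ℕ)
    (h : List (Z × E)) (hh : ∀ x ∈ h, x.2 ∈ F) :
    valueAfter l F n h ≤ (h.map fun x => l x.1 x.2).sum - minExpectedLoss l F (movesMeasure h)
      + ∑ k ∈ Finset.range n, 2 * α / (h.length + k + 1) := by
  induction n generalizing h with
  | zero =>
    rw [valueAfter, regret, minExpectedLoss]
    simp [fun f : F => integral_movesMeasure (hmeas f f.2) (fun z => hM z f f.2) h]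
  | succ n ih =>
    obtain ⟨f, hf, hfz⟩ := exists_forall_le_minExpectedLoss hF hF_conv hF_ne hmeas hcont hconv hM
      hα h_flat (movesMeasure h) rfl
    have hmem : ∀ g ∈ F, ∀ z : Z, ∀ x ∈ (z, g) :: h, x.2 ∈ F := by
      intro g hg z x hx
      rcases List.mem_cons.1 hx with rfl | hx
      · exact hg
      · exact hh x hx
    rw [valueAfter]
    refine (ciInf_le ⟨-(2 * M * (h.length + 1 + n)), ?_⟩ ⟨f, hf⟩).trans (ciSup_le fun z => ?_)
    · rintro _ ⟨g, rfl⟩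
      refine (abs_le.1 (abs_iSup_le fun z => ?_)).1
      simpa using abs_valueAfter_le hF_ne hM n ((z, (g : E)) :: h) (hmem g g.2 z)
    · refine (ih _ (hmem f hf z)).trans ?_
      have h1 := hfz z
      rw [measureReal_movesMeasure_univ, add_comm (movesMeasure h)] at h1
      rw [Finset.sum_range_succ', movesMeasure_cons]
      simp only [List.map_cons, List.sum_cons, List.length_cons, Nat.cast_add, Nat.cast_one,
        Nat.cast_zero, add_zero]
      have h2 : ∀ k : ℕ, 2 * α / ((h.length : ℝ) + 1 + k + 1)
          = 2 * α / ((h.length : ℝ) + (k + 1) + 1) := fun k => by ring_nf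
      simp only [h2]
      linarith

end Game

end OnlineConvex

theorem mainTheorem3 {Z E : Type*}
    [TopologicalSpace Z] [CompactSpace Z] [Nonempty Z] [MeasurableSpace Z] [BorelSpace Z]
    [AddCommGroup E] [Module ℝ E] [TopologicalSpace E] [IsTopologicalAddGroup E]
    [ContinuousSMul ℝ E]
    (F : Set E) (hF : IsCompact F) (hF_conv : Convex ℝ F) (hF_ne : F.Nonempty)
    (l : Z → E → ℝ)
    (hl_cont : ContinuousOn (Function.uncurry l) (Set.univ ×ˢ F))
    (hl_conv : ∀ z, ConvexOn ℝ F (l z))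
    (α : ℝ) (hα : 0 ≤ α)
    (h_diff : OnlineConvex.DifferentiableOnDistributions (OnlineConvex.minExpectedLoss l F))
    (h_flat : OnlineConvex.IsFlatConcave α (OnlineConvex.minExpectedLoss l F))
    (T : ℕ) (hT : 1 ≤ T) :
    OnlineConvex.minimaxRegret l F T ≤ 4 * α * (1 + Real.log T) ∧
      (3 ≤ T → OnlineConvex.minimaxRegret l F T ≤ 4 * α * Real.log T) := by
  obtain ⟨M, hM⟩ := (isCompact_univ.prod hF).exists_bound_of_continuousOn hl_cont
  have hmeas : ∀ f ∈ F, StronglyMeasurable fun z => l z f := fun f hf =>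
    (hl_cont.comp_continuous (f := fun z => (z, f)) (by fun_prop)
      fun z => ⟨Set.mem_univ z, hf⟩).measurable.stronglyMeasurable
  have hcont : ∀ z, ContinuousOn (l z) F := fun z =>
    hl_cont.comp (f := fun f => (z, f)) (by fun_prop) fun f hf => ⟨Set.mem_univ z, hf⟩
  have : Nonempty F := hF_ne.to_subtype
  have key : OnlineConvex.minimaxRegret l F T ≤ 2 * α * (1 + Real.log T) := by
    refine (OnlineConvex.valueAfter_le hF hF_conv hF_ne hmeas hcont hl_conv
      (fun z f hf => hM (z, f) ⟨Set.mem_univ z, hf⟩) hα h_flat T [] (by simp)).trans ?_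
    -- For the empty play the potential is 0 and the errors add up to 2α times the harmonic number.
    have h1 := mul_le_mul_of_nonneg_left (harmonic_le_one_add_log T)
      (mul_nonneg zero_le_two hα)
    refine le_trans (le_of_eq ?_) h1
    simp [OnlineConvex.movesMeasure, OnlineConvex.minExpectedLoss, harmonic, Finset.mul_sum,
      div_eq_mul_inv]
  have hlog : 0 ≤ Real.log T := Real.log_natCast_nonneg T
  refine ⟨key.trans (by nlinarith [mul_nonneg hα hlog]), fun h3 => key.trans ?_⟩
  -- As e < 3, the summand 1 is absorbed: 2α(1 + log T) ≤ 4α log T.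
  have h1 : 1 ≤ Real.log T := by
    rw [Real.le_log_iff_exp_le (by positivity)]
    have : (3 : ℝ) ≤ T := by exact_mod_cast h3
    linarith [Real.exp_one_lt_d9]
  nlinarith [mul_le_mul_of_nonneg_left h1 hα]
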